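/- Let $(P,\le)$ be a finite poset and $\mathbb K$ a field. For $n\ge 0$ let $C^n$ be the set of chains $(a_0\le a_1\le\dots\le a_n)$ in $P$ (the $n$-simplices of the order complex $\Delta(P)$), let $E^n$ be the multiplicative group of all functions $C^n\to\mathbb K^*$, and let $\delta\colon E^n\to E^{n+1}$ be given by $$(\delta f)(a_0,\dots,a_{n+1})=\prod_{i=0}^{n+1} f(a_0,\dots,a_{i-1},a_{i+1},\dots,a_{n+1})^{(-1)^i}.$$ Let $H^2(\Delta(P),\mathbb K^*)=\ker(\delta\colon E^2\to E^3)/\operatorname{Im}(\delta\colon E^1\to E^2)$. The group $\operatorname{Aut}(P,\le)$ of order automorphisms acts on the right on $H^2(\Delta(P),\mathbb K^*)$ by $[\lambda]^\sigma=[\lambda^\sigma]$, where $\lambda^\sigma(x,y,z)=\lambda(\sigma x,\sigma y,\sigma z)$. For $\lambda\in E^2$ let $I_\lambda(P,\mathbb K)$ be the $\mathbb K$-vector space with basis $\{f_{xy} : x\le y\}$ and the bilinear multiplication $f_{xy}*f_{yz}=\lambda(x,y,z)f_{xz}$ and $f_{xy}*f_{tz}=0$ for $y\ne t$. A deformation of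 the incidence algebra of $P$ over $\mathbb K$ is an $I_\lambda(P,\mathbb K)$ whose multiplication is associative; it is then a unital $\mathbb K$-algebra. If $I_\lambda(P,\mathbb K)$ is associative, then $\lambda\in\ker(\delta\colon E^2\to E^3)$, and sending the isomorphism class (as a $\mathbb K$-algebra) of $I_\lambda(P,\mathbb K)$ to the $\operatorname{Aut}(P,\le)$-orbit of $[\lambda]$ is a well-defined bijection from the set of isomorphism classes of deformations $I_\lambda(P,\mathbb K)$ of the incidence algebra of $P$ onto the set of orbits $H^2(\Delta(P),\mathbb K^*)/\operatorname{Aut}(P,\le)$. -/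

import Mathlib

namespace PosetDeformation

universe u v

/-! ### The order complex and its cohomology with coefficients in the group of units -/

section Cohomology

variable (P : Type u) [PartialOrder P] (K : Type v) [Field K]

/-- The `n`-simplices of the order complex of `P`: the chains `a₀ ≤ a₁ ≤ ⋯ ≤ aₙ` in `P`. -/
abbrev Chain (n : ℕ) : Type u := Fin (n + 1) →o P

variable {P}

/-- The `i`-th face of a simplex: drop the `i`-th entry of the chain. -/
def face {n : ℕ} (s : Chain P (n + 1)) (i : Fin (n + 2)) : Chain P n :=
  s.comp (Fin.succAboveOrderEmb i).toOrderHom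

variable (P)

/-- The multiplicative group of `n`-cochains: functions on the `n`-simplices with values in the
group of units of `K` (the same as homomorphisms to it from the free abelian group on the
`n`-simplices). -/
abbrev Cochain (n : ℕ) : Type (max u v) := Chain P n → Kˣ

/-- The coboundary, in multiplicative notation:
`(δ f)(a₀, …, aₙ₊₁) = ∏ i, f(a₀, …, âᵢ, …, aₙ₊₁) ^ ((-1) ^ i)`. -/
def coboundary (n : ℕ) : Cochain P K n →* Cochain P K (n + 1) where
  toFun f s := ∏ i : Fin (n + 2), f (face s i) ^ ((-1 : ℤ) ^ (i : ℕ))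
  map_one' := by
    funext s
    simp
  map_mul' f g := by
    funext s
    simp [mul_zpow, Finset.prod_mul_distrib]

/-- The group of `n`-cocycles. -/
def cocycles (n : ℕ) : Subgroup (Cochain P K n) := (coboundary P K n).ker

/-- The group of `n`-coboundaries. -/
def coboundaries : (n : ℕ) → Subgroup (Cochain P K n)
  | 0 => ⊥
  | n + 1 => (coboundary P K n).range

/-- The cohomology group `Hⁿ(Δ(P), Kˣ)`: cocycles modulo coboundaries. -/
abbrev Cohomology (n : ℕ) : Type (max u v) :=
  cocycles P K n ⧸ (coboundaries P K n).subgroupOf (cocycles P K n)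

/-- The class of a cocycle in cohomology. -/
def cohomologyClass {n : ℕ} (f : cocycles P K n) : Cohomology P K n := QuotientGroup.mk f

/-! ### The right action of the automorphism group of the poset on cohomology -/

/-- The action of an automorphism on cochains,
`f ^ σ = f (σ a₀, …, σ aₙ)`. -/
def pullback (n : ℕ) (σ : P ≃o P) : Cochain P K n →* Cochain P K n where
  toFun f s := f ((σ : P →o P).comp s)
  map_one' := rfl
  map_mul' _ _ := rfl

theorem coboundary_pullback (n : ℕ) (σ : P ≃o P) (f : Cochain P K n) :
    coboundary P K n (pullback P K n σ f) = pullback P K (n + 1) σ (coboundary P K n f) := rfl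

theorem pullback_mem_cocycles (n : ℕ) (σ : P ≃o P) {f : Cochain P K n}
    (hf : f ∈ cocycles P K n) : pullback P K n σ f ∈ cocycles P K n := by
  have h : coboundary P K n f = 1 := hf
  change coboundary P K n (pullback P K n σ f) = 1
  rw [coboundary_pullback, h, map_one]

theorem pullback_mem_coboundaries (n : ℕ) (σ : P ≃o P) {f : Cochain P K n}
    (hf : f ∈ coboundaries P K n) : pullback P K n σ f ∈ coboundaries P K n := by
  cases n with
  | zero =>
    have h : f = 1 := hf
    rw [h, map_one]
    exact one_mem _
  | succ n =>
    obtain ⟨g, rfl⟩ := hf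
    exact ⟨pullback P K n σ g, coboundary_pullback P K n σ g⟩

/-- The action of an automorphism on cocycles. -/
def pullbackCocycles (n : ℕ) (σ : P ≃o P) : cocycles P K n →* cocycles P K n where
  toFun f := ⟨pullback P K n σ f.1, pullback_mem_cocycles P K n σ f.2⟩
  map_one' := rfl
  map_mul' _ _ := rfl

/-- The action of an automorphism on cohomology: `[f] ^ σ = [f ^ σ]`. -/
def pullbackCohomology (n : ℕ) (σ : P ≃o P) : Cohomology P K n →* Cohomology P K n :=
  QuotientGroup.map _ _ (pullbackCocycles P K n σ)
    (fun _ hf => pullback_mem_coboundaries P K n σ hf)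

/-- The right action of the group `Aut(P, ≤)` on `Hⁿ(Δ(P), Kˣ)`, that is, an action of the opposite
group. -/
instance autAction (n : ℕ) : MulAction (P ≃o P)ᵐᵒᵖ (Cohomology P K n) where
  smul σ c := pullbackCohomology P K n σ.unop c
  one_smul c := by
    induction c using QuotientGroup.induction_on
    rfl
  mul_smul σ τ c := by
    induction c using QuotientGroup.induction_on
    rfl

/-- The set `Hⁿ(Δ(P), Kˣ) / Aut(P, ≤)` of orbits. -/
abbrev CohomologyOrbits (n : ℕ) : Type (max u v) :=
  MulAction.orbitRel.Quotient (P ≃o P)ᵐᵒᵖ (Cohomology P K n)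

/-- The orbit of a cohomology class. -/
def cohomologyOrbit {n : ℕ} (c : Cohomology P K n) : CohomologyOrbits P K n :=
  Quotient.mk (MulAction.orbitRel (P ≃o P)ᵐᵒᵖ (Cohomology P K n)) c

end Cohomology

/-! ### Deformations of the incidence algebra -/

section Deformation

variable {P : Type u} [PartialOrder P] {K : Type v} [Field K]

/-- The chain `x ≤ y ≤ z` as a `2`-simplex. -/
def triple (x y z : P) (hxy : x ≤ y) (hyz : y ≤ z) : Chain P 2 where
  toFun := ![x, y, z]
  monotone' := by
    rw [Fin.monotone_iff_le_succ]
    intro i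
    fin_cases i
    · exact hxy
    · exact hyz

/-- The underlying vector space of the deformation `I_lam(P, K)` is that of the incidence algebra:
functions `f` on `P × P` with `f (x, y) = 0` unless `x ≤ y`. -/
def DeformedAlgebra (_lam : Cochain P K 2) : Type (max u v) := IncidenceAlgebra K P

namespace DeformedAlgebra

variable (lam : Cochain P K 2)

instance : AddCommGroup (DeformedAlgebra lam) := inferInstanceAs (AddCommGroup (IncidenceAlgebra K P))

instance : Module K (DeformedAlgebra lam) := inferInstanceAs (Module K (IncidenceAlgebra K P))

variable {lam}

/-- The value `f (x, y)`. -/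
def val (f : DeformedAlgebra lam) (x y : P) : K := IncidenceAlgebra.toFun f x y

theorem val_ext {f g : DeformedAlgebra lam} (h : ∀ x y, x ≤ y → f.val x y = g.val x y) : f = g :=
  IncidenceAlgebra.ext h

theorem val_add (f g : DeformedAlgebra lam) (x y : P) : (f + g).val x y = f.val x y + g.val x y :=
  rfl

theorem val_zero (x y : P) : (0 : DeformedAlgebra lam).val x y = 0 := rfl

theorem val_smul (c : K) (f : DeformedAlgebra lam) (x y : P) : (c • f).val x y = c * f.val x y :=
  rfl

variable (lam) in
open Classical in
/-- The basis element `f_{xy}`, for `x ≤ y`. -/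
noncomputable def basisElt (x y : P) (h : x ≤ y) : DeformedAlgebra lam where
  toFun a b := if a = x ∧ b = y then 1 else 0
  eq_zero_of_not_le' a b hab := if_neg (by rintro ⟨rfl, rfl⟩; exact hab h)

open Classical in
theorem val_basisElt (x y : P) (h : x ≤ y) (a b : P) :
    (basisElt lam x y h).val a b = if a = x ∧ b = y then 1 else 0 := rfl

variable [Fintype P]

open Classical in
/-- The deformed multiplication,
`(f * g)(x, y) = ∑_{x ≤ z ≤ y} lam(x, z, y) f(x, z) g(z, y)`;
this is the bilinear map given on the basis by `f_{xy} * f_{yz} = lam(x, y, z) f_{xz}` and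
`f_{xy} * f_{tz} = 0` for `y ≠ t`, see `basisElt_mul_basisElt` and `basisElt_mul_basisElt_of_ne`. -/
noncomputable instance : Mul (DeformedAlgebra lam) where
  mul f g :=
    { toFun := fun x y => ∑ z : P, if h : x ≤ z ∧ z ≤ y then
        (lam (triple x z y h.1 h.2) : K) * (f.val x z * g.val z y) else 0
      eq_zero_of_not_le' := fun x y hxy =>
        Finset.sum_eq_zero fun _ _ => dif_neg fun h => hxy (h.1.trans h.2) }

open Classical in
theorem val_mul (f g : DeformedAlgebra lam) (x y : P) :
    (f * g).val x y = ∑ z : P, if h : x ≤ z ∧ z ≤ y then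
      (lam (triple x z y h.1 h.2) : K) * (f.val x z * g.val z y) else 0 := rfl

noncomputable instance : NonUnitalNonAssocRing (DeformedAlgebra lam) where
  left_distrib f g h := by
    refine val_ext fun x y _ => ?_
    simp only [val_add, val_mul, ← Finset.sum_add_distrib]
    refine Finset.sum_congr rfl fun z _ => ?_
    split_ifs <;> ring
  right_distrib f g h := by
    refine val_ext fun x y _ => ?_
    simp only [val_add, val_mul, ← Finset.sum_add_distrib]
    refine Finset.sum_congr rfl fun z _ => ?_
    split_ifs <;> ring
  zero_mul f := by
    refine val_ext fun x y _ => ?_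
    simp [val_mul, val_zero]
  mul_zero f := by
    refine val_ext fun x y _ => ?_
    simp [val_mul, val_zero]

theorem smul_mul_eq (c : K) (f g : DeformedAlgebra lam) : (c • f) * g = c • (f * g) := by
  refine val_ext fun x y _ => ?_
  simp only [val_smul, val_mul, Finset.mul_sum]
  refine Finset.sum_congr rfl fun z _ => ?_
  split_ifs <;> ring

theorem mul_smul_eq (c : K) (f g : DeformedAlgebra lam) : f * (c • g) = c • (f * g) := by
  refine val_ext fun x y _ => ?_
  simp only [val_smul, val_mul, Finset.mul_sum]
  refine Finset.sum_congr rfl fun z _ => ?_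
  split_ifs <;> ring

theorem basisElt_mul_basisElt (x y z : P) (hxy : x ≤ y) (hyz : y ≤ z) :
    basisElt lam x y hxy * basisElt lam y z hyz =
      (lam (triple x y z hxy hyz) : K) • basisElt lam x z (hxy.trans hyz) := by
  classical
  refine val_ext fun a b _ => ?_
  simp only [val_smul, val_mul, val_basisElt]
  rw [Finset.sum_eq_single y]
  · by_cases ha : a = x
    · by_cases hb : b = z
      · subst ha hb
        simp [hxy, hyz]
      · simp [hb]
    · simp [ha]
  · intro w _ hw
    simp [hw]
  · simp

theorem basisElt_mul_basisElt_of_ne (x y t z : P) (hxy : x ≤ y) (htz : t ≤ z) (h : y ≠ t) :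
    basisElt lam x y hxy * basisElt lam t z htz = 0 := by
  classical
  refine val_ext fun a b _ => ?_
  simp only [val_zero, val_mul, val_basisElt]
  refine Finset.sum_eq_zero fun w _ => ?_
  by_cases hw : w = y
  · subst hw
    simp [h]
  · simp [hw]

end DeformedAlgebra

open DeformedAlgebra

variable [Fintype P]

/-- Associativity of the deformed multiplication. -/
def IsAssoc (lam : Cochain P K 2) : Prop :=
  ∀ f g h : DeformedAlgebra lam, f * g * h = f * (g * h)

theorem IsAssoc.left_eq {lam : Cochain P K 2} (hl : IsAssoc lam) (x y : P) (h : x ≤ y) :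
    lam (triple x x y le_rfl h) = lam (triple x x x le_rfl le_rfl) := by
  classical
  have h1 := congrArg (fun f => f.val x y)
    (hl (basisElt lam x x le_rfl) (basisElt lam x x le_rfl) (basisElt lam x y h))
  simp only [basisElt_mul_basisElt, smul_mul_eq, mul_smul_eq, val_smul, val_basisElt] at h1
  simp only [and_self, if_true, mul_one, ← Units.val_mul] at h1
  exact (mul_right_cancel (Units.ext h1)).symm

theorem IsAssoc.right_eq {lam : Cochain P K 2} (hl : IsAssoc lam) (x y : P) (h : x ≤ y) :
    lam (triple x y y h le_rfl) = lam (triple y y y le_rfl le_rfl) := by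
  classical
  have h1 := congrArg (fun f => f.val x y)
    (hl (basisElt lam x y h) (basisElt lam y y le_rfl) (basisElt lam y y le_rfl))
  simp only [basisElt_mul_basisElt, smul_mul_eq, mul_smul_eq, val_smul, val_basisElt] at h1
  simp only [and_self, if_true, mul_one, ← Units.val_mul] at h1
  exact mul_right_cancel (Units.ext h1)

variable (P K) in
/-- The families of nonzero scalars `lam(x, y, z)`, `x ≤ y ≤ z`, for which the deformed
multiplication is associative. -/
abbrev AssocParam : Type (max u v) := {lam : Cochain P K 2 // IsAssoc lam}

/-- The deformation `I_lam(P, K)`, an associative `K`-algebra. -/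
abbrev Deformation (lam : AssocParam P K) : Type (max u v) := DeformedAlgebra lam.1

open Classical in
/-- The identity element `∑ x, lam(x, x, x)⁻¹ f_{xx}`. -/
noncomputable instance (lam : AssocParam P K) : One (Deformation lam) where
  one :=
    { toFun := fun x y => if x = y then ((lam.1 (triple x x x le_rfl le_rfl))⁻¹ : Kˣ) else 0
      eq_zero_of_not_le' := fun _ _ hxy => if_neg fun h => hxy h.le }

open Classical in
theorem val_one (lam : AssocParam P K) (x y : P) :
    (1 : Deformation lam).val x y =
      if x = y then (((lam.1 (triple x x x le_rfl le_rfl))⁻¹ : Kˣ) : K) else 0 := rfl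

noncomputable instance (lam : AssocParam P K) : Ring (Deformation lam) where
  __ := (inferInstance : NonUnitalNonAssocRing (DeformedAlgebra lam.1))
  one := 1
  mul_assoc := lam.2
  one_mul f := by
    classical
    refine val_ext fun x y hxy => ?_
    rw [val_mul, Finset.sum_eq_single x]
    · rw [dif_pos ⟨le_rfl, hxy⟩, val_one, if_pos rfl, lam.2.left_eq x y hxy, ← mul_assoc,
        Units.mul_inv, one_mul]
    · intro z _ hz
      simp [val_one, hz.symm]
    · simp
  mul_one f := by
    classical
    refine val_ext fun x y hxy => ?_
    rw [val_mul, Finset.sum_eq_single y]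
    · rw [dif_pos ⟨hxy, le_rfl⟩, val_one, if_pos rfl, lam.2.right_eq x y hxy,
        mul_comm (f.val x y), ← mul_assoc, Units.mul_inv, one_mul]
    · intro z _ hz
      simp [val_one, hz]
    · simp

noncomputable instance (lam : AssocParam P K) : Algebra K (Deformation lam) :=
  Algebra.ofModule smul_mul_eq mul_smul_eq

variable (P K) in
/-- Isomorphism of the deformations as `K`-algebras. -/
def isoSetoid : Setoid (AssocParam P K) where
  r lam mu := Nonempty (Deformation lam ≃ₐ[K] Deformation mu)
  iseqv :=
    { refl := fun _ => ⟨AlgEquiv.refl⟩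
      symm := fun ⟨e⟩ => ⟨e.symm⟩
      trans := fun ⟨e⟩ ⟨e'⟩ => ⟨e.trans e'⟩ }

variable (P K) in
/-- The set of isomorphism classes of deformations `I_lam(P, K)`. -/
abbrev DeformationClasses : Type (max u v) := Quotient (isoSetoid P K)

/-- The isomorphism class of the deformation `I_lam(P, K)`. -/
def deformationClass (lam : AssocParam P K) : DeformationClasses P K :=
  Quotient.mk (isoSetoid P K) lam

end Deformation

end PosetDeformation

namespace PosetDeformation

universe u v

/-! ### Coboundaries in low degree in terms of explicit chains -/

section Cochains

open DeformedAlgebra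

variable {P : Type u} [PartialOrder P] {K : Type v} [Field K]

/-! Associativity on `f_{xy}, f_{yz}, f_{zt}` is the 2-cocycle equation, so the parameters are
exactly the cocycles (`IsAssoc.mem_cocycles`, `isAssoc_of_mem_cocycles`). If `lam` is the pullback
of `mu` along `σ` times `δ g`, rescaling the basis by `g` and relabelling by `σ` is an isomorphism
(`deformationEquiv`).

Conversely, let `φ` be an isomorphism. The only algebra maps to `K` are the normalized diagonal
entries (`exists_eq_character`), so `φ` induces a permutation `σ` of `P`. After an inner
automorphism, `φ` carries the diagonal idempotent `e_x` to `e_{σ x}` (`exists_algEquiv_map_idem`).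
The corner `e_x A e_y` is the line through `f_{xy}` if `x ≤ y` and zero otherwise. Hence `σ`
preserves the order, and `φ f_{xy} = g(x, y) f_{σx,σy}` with nonzero scalars `g`; comparing products
shows that `lam` is the pullback of `mu` times `δ g` (`exists_pullback_mul_coboundary`). -/

theorem mul_mul_inv_mul_mul_eq {G : Type*} [CommGroup G] (m a b c : G) :
    m * (a * b⁻¹ * c) * b = c * a * m := by
  rw [mul_right_comm a, mul_assoc, inv_mul_cancel_right, mul_comm m, mul_comm a]

/-- The chain `x ≤ y` as a `1`-simplex. -/
def pair (x y : P) (h : x ≤ y) : Chain P 1 where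
  toFun := ![x, y]
  monotone' := by
    rw [Fin.monotone_iff_le_succ]
    intro i
    fin_cases i
    exact h

theorem chain_two_eq_triple (s : Chain P 2) :
    s = triple (s 0) (s 1) (s 2) (s.monotone (by decide)) (s.monotone (by decide)) := by
  ext i
  fin_cases i <;> rfl

theorem coboundary_one_triple (g : Cochain P K 1) (x y z : P) (hxy : x ≤ y) (hyz : y ≤ z) :
    coboundary P K 1 g (triple x y z hxy hyz) =
      g (pair y z hyz) * (g (pair x z (hxy.trans hyz)))⁻¹ * g (pair x y hxy) := by
  have h0 : face (triple x y z hxy hyz) 0 = pair y z hyz := by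
    ext i; fin_cases i <;> rfl
  have h1 : face (triple x y z hxy hyz) 1 = pair x z (hxy.trans hyz) := by
    ext i; fin_cases i <;> rfl
  have h2 : face (triple x y z hxy hyz) 2 = pair x y hxy := by
    ext i; fin_cases i <;> rfl
  change ∏ i : Fin 3, g (face (triple x y z hxy hyz) i) ^ ((-1 : ℤ) ^ (i : ℕ)) = _
  simp [Fin.prod_univ_three, h0, h1, h2]

theorem coboundary_two_apply (f : Cochain P K 2) (s : Chain P 3) :
    coboundary P K 2 f s =
      f (triple (s 1) (s 2) (s 3) (s.monotone (by decide)) (s.monotone (by decide))) *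
      (f (triple (s 0) (s 2) (s 3) (s.monotone (by decide)) (s.monotone (by decide))))⁻¹ *
      f (triple (s 0) (s 1) (s 3) (s.monotone (by decide)) (s.monotone (by decide))) *
      (f (triple (s 0) (s 1) (s 2) (s.monotone (by decide)) (s.monotone (by decide))))⁻¹ := by
  have h0 : face s 0 =
      triple (s 1) (s 2) (s 3) (s.monotone (by decide)) (s.monotone (by decide)) := by
    ext i; fin_cases i <;> rfl
  have h1 : face s 1 =
      triple (s 0) (s 2) (s 3) (s.monotone (by decide)) (s.monotone (by decide)) := by
    ext i; fin_cases i <;> rfl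
  have h2 : face s 2 =
      triple (s 0) (s 1) (s 3) (s.monotone (by decide)) (s.monotone (by decide)) := by
    ext i; fin_cases i <;> rfl
  have h3 : face s 3 =
      triple (s 0) (s 1) (s 2) (s.monotone (by decide)) (s.monotone (by decide)) := by
    ext i; fin_cases i <;> rfl
  change ∏ i : Fin 4, f (face s i) ^ ((-1 : ℤ) ^ (i : ℕ)) = _
  have e : ((-1 : ℤ) ^ 3) = -1 := by norm_num
  simp [Fin.prod_univ_four, h0, h1, h2, h3, e]

/-- The chain `x ≤ y ≤ z ≤ t` as a `3`-simplex. -/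
def quadruple (x y z t : P) (hxy : x ≤ y) (hyz : y ≤ z) (hzt : z ≤ t) : Chain P 3 where
  toFun := ![x, y, z, t]
  monotone' := by
    rw [Fin.monotone_iff_le_succ]
    intro i
    fin_cases i
    · exact hxy
    · exact hyz
    · exact hzt

/-- The inverse-free form of the cocycle condition, in the shape that associativity produces. -/
theorem mem_cocycles_two_iff (f : Cochain P K 2) :
    f ∈ cocycles P K 2 ↔ ∀ (x y z t : P) (hxy : x ≤ y) (hyz : y ≤ z) (hzt : z ≤ t),
      f (triple x y z hxy hyz) * f (triple x z t (hxy.trans hyz) hzt) =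
        f (triple y z t hyz hzt) * f (triple x y t hxy (hyz.trans hzt)) := by
  have key (a b c d : Kˣ) : a * b⁻¹ * c * d⁻¹ = 1 ↔ d * b = a * c := by
    rw [mul_inv_eq_one, mul_right_comm, mul_inv_eq_iff_eq_mul, eq_comm]
  constructor
  · intro hf x y z t hxy hyz hzt
    have h : coboundary P K 2 f = 1 := hf
    have h' := congrFun h (quadruple x y z t hxy hyz hzt)
    rw [coboundary_two_apply, Pi.one_apply, key] at h'
    exact h'
  · intro h
    change coboundary P K 2 f = 1
    funext s
    rw [coboundary_two_apply, Pi.one_apply, key]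
    exact h _ _ _ _ _ _ _

theorem val_eq_zero {lam : Cochain P K 2} (f : DeformedAlgebra lam) {x y : P} (h : ¬ x ≤ y) :
    f.val x y = 0 :=
  IncidenceAlgebra.apply_eq_zero_of_not_le h f

theorem val_sum {lam : Cochain P K 2} {ι : Type*} (s : Finset ι) (f : ι → DeformedAlgebra lam)
    (a b : P) : (∑ i ∈ s, f i).val a b = ∑ i ∈ s, (f i).val a b := by
  classical
  induction s using Finset.induction_on with
  | empty => simp [val_zero]
  | insert i s hi ih => rw [Finset.sum_insert hi, Finset.sum_insert hi, val_add, ih]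

theorem basisElt_ne_zero (lam : Cochain P K 2) (x y : P) (h : x ≤ y) :
    basisElt lam x y h ≠ 0 := fun h0 => by
  have := congrArg (fun f => f.val x y) h0
  simp [val_basisElt, val_zero] at this

end Cochains

/-! ### Associativity, isomorphisms and the classification -/

section Algebra

open DeformedAlgebra

variable {P : Type u} [PartialOrder P] [Fintype P] {K : Type v} [Field K]

theorem IsAssoc.mem_cocycles {lam : Cochain P K 2} (hl : IsAssoc lam) :
    lam ∈ cocycles P K 2 := by
  classical
  rw [mem_cocycles_two_iff]
  intro x y z t hxy hyz hzt
  have h1 := congrArg (fun f => f.val x t)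
    (hl (basisElt lam x y hxy) (basisElt lam y z hyz) (basisElt lam z t hzt))
  simp only [basisElt_mul_basisElt, smul_mul_eq, mul_smul_eq, val_smul, val_basisElt] at h1
  simp only [and_self, if_true, mul_one, ← Units.val_mul] at h1
  exact Units.ext h1

-- Both bracketings expand to one double sum over `x ≤ w ≤ z ≤ y`; the coefficients agree by the
-- cocycle equation for `x, w, z, y`.
open Classical in
theorem isAssoc_of_mem_cocycles {lam : Cochain P K 2} (hl : lam ∈ cocycles P K 2) :
    IsAssoc lam := by
  rw [mem_cocycles_two_iff] at hl
  intro f g h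
  refine val_ext fun x y _ => ?_
  have expand_left (z : P) : (if hz : x ≤ z ∧ z ≤ y then
      (lam (triple x z y hz.1 hz.2) : K) * ((f * g).val x z * h.val z y) else 0) =
      ∑ w : P, if hw : x ≤ w ∧ w ≤ z ∧ z ≤ y then
        (lam (triple x w z hw.1 hw.2.1) : K) *
          (lam (triple x z y (hw.1.trans hw.2.1) hw.2.2) : K) *
          (f.val x w * g.val w z * h.val z y) else 0 := by
    split_ifs with hz
    · rw [val_mul, Finset.sum_mul, Finset.mul_sum]
      refine Finset.sum_congr rfl fun w _ => ?_
      by_cases hw : x ≤ w ∧ w ≤ z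
      · rw [dif_pos hw, dif_pos ⟨hw.1, hw.2, hz.2⟩]
        ring
      · rw [dif_neg hw, dif_neg fun h' => hw ⟨h'.1, h'.2.1⟩]
        ring
    · refine (Finset.sum_eq_zero fun w _ => dif_neg fun h' => hz ?_).symm
      exact ⟨h'.1.trans h'.2.1, h'.2.2⟩
  have expand_right (w : P) : (if hw : x ≤ w ∧ w ≤ y then
      (lam (triple x w y hw.1 hw.2) : K) * (f.val x w * (g * h).val w y) else 0) =
      ∑ z : P, if hw : x ≤ w ∧ w ≤ z ∧ z ≤ y then
        (lam (triple x w z hw.1 hw.2.1) : K) *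
          (lam (triple x z y (hw.1.trans hw.2.1) hw.2.2) : K) *
          (f.val x w * g.val w z * h.val z y) else 0 := by
    split_ifs with hw
    · rw [val_mul, Finset.mul_sum, Finset.mul_sum]
      refine Finset.sum_congr rfl fun z _ => ?_
      by_cases hz : w ≤ z ∧ z ≤ y
      -- The only use of the cocycle equation: it rewrites the common coefficient into that of the
      -- right bracketing.
      · rw [dif_pos hz, dif_pos ⟨hw.1, hz.1, hz.2⟩, ← Units.val_mul,
          hl x w z y hw.1 hz.1 hz.2, Units.val_mul]
        ring
      · rw [dif_neg hz, dif_neg fun h' => hz h'.2]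
        ring
    · refine (Finset.sum_eq_zero fun z _ => dif_neg fun h' => hw ?_).symm
      exact ⟨h'.1, h'.2.1.trans h'.2.2⟩
  rw [val_mul, val_mul, Finset.sum_congr rfl fun z _ => expand_left z,
    Finset.sum_congr rfl fun w _ => expand_right w, Finset.sum_comm]

/-! ### Isomorphisms from an automorphism of the poset and a coboundary -/

open Classical in
/-- The isomorphism `f_{σx,σy} ↦ g(x, y)⁻¹ f_{xy}`, when `lam` and the pullback of `mu` along `σ`
differ by the coboundary of `g`. -/
noncomputable def deformationEquiv (lam mu : AssocParam P K) (σ : P ≃o P) (g : Cochain P K 1)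
    (h : ∀ (x y z : P) (hxy : x ≤ y) (hyz : y ≤ z),
      lam.1 (triple x y z hxy hyz) * g (pair x z (hxy.trans hyz)) =
        g (pair x y hxy) * g (pair y z hyz) *
          mu.1 (triple (σ x) (σ y) (σ z) (σ.monotone hxy) (σ.monotone hyz))) :
    Deformation mu ≃ₐ[K] Deformation lam :=
  AlgEquiv.ofLinearEquiv
    { toFun := fun f =>
        { toFun := fun x y => if hxy : x ≤ y then
            ((g (pair x y hxy))⁻¹ : Kˣ) * f.val (σ x) (σ y) else 0
          eq_zero_of_not_le' := fun x y hxy => dif_neg hxy }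
      invFun := fun f =>
        { toFun := fun x y => if hxy : x ≤ y then
            (g (pair (σ.symm x) (σ.symm y) (σ.symm.monotone hxy)) : K) *
              f.val (σ.symm x) (σ.symm y) else 0
          eq_zero_of_not_le' := fun x y hxy => dif_neg hxy }
      map_add' := fun f f' => by
        refine val_ext fun x y hxy => ?_
        change dite (x ≤ y) _ _ = (dite (x ≤ y) _ _ + dite (x ≤ y) _ _ : K)
        rw [dif_pos hxy, dif_pos hxy, dif_pos hxy, val_add, mul_add]
      map_smul' := fun c f => by
        refine val_ext fun x y hxy => ?_
        change dite (x ≤ y) _ _ = c * dite (x ≤ y) _ _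
        rw [dif_pos hxy, dif_pos hxy, val_smul, mul_left_comm]
      left_inv := fun f => by
        refine val_ext fun x y hxy => ?_
        simp [val, hxy]
      right_inv := fun f => by
        refine val_ext fun x y hxy => ?_
        simp [val, hxy] }
    (by
      refine val_ext fun x y hxy => ?_
      change (if hxy : x ≤ y then
            (((g (pair x y hxy))⁻¹ : Kˣ) : K) * (1 : Deformation mu).val (σ x) (σ y) else 0) = _
      rw [dif_pos hxy, val_one, val_one]
      by_cases e : x = y
      · subst e
        rw [if_pos rfl, if_pos rfl, ← Units.val_mul]
        congr 1
        -- On the constant chain the relation reads `lam(x,x,x) = g(x,x) mu(σx,σx,σx)`, which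
        -- matches the two identity elements.
        have := h x x x le_rfl le_rfl
        rw [mul_comm, mul_assoc, mul_right_inj] at this
        rw [this, mul_inv]
      · rw [if_neg e, if_neg (fun h => e (σ.injective h)), mul_zero])
    (fun f f' => by
      refine val_ext fun x y hxy => ?_
      rw [val_mul]
      change (if hxy : x ≤ y then
            (((g (pair x y hxy))⁻¹ : Kˣ) : K) * (f * f').val (σ x) (σ y) else 0) = _
      rw [dif_pos hxy, val_mul, ← σ.toEquiv.sum_comp, Finset.mul_sum]
      refine Finset.sum_congr rfl fun z _ => ?_
      by_cases hz : x ≤ z ∧ z ≤ y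
      · rw [dif_pos hz, dif_pos ⟨σ.monotone hz.1, σ.monotone hz.2⟩]
        change _ = _ * ((if hxz : x ≤ z then
            (((g (pair x z hxz))⁻¹ : Kˣ) : K) * f.val (σ x) (σ z) else 0) *
          (if hzy : z ≤ y then
            (((g (pair z y hzy))⁻¹ : Kˣ) : K) * f'.val (σ z) (σ y) else 0))
        rw [dif_pos hz.1, dif_pos hz.2]
        have key := congrArg (Units.val) (h x z y hz.1 hz.2)
        simp only [Units.val_mul] at key
        have h1 := (g (pair x y hxy)).ne_zero
        have h2 := (g (pair x z hz.1)).ne_zero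
        have h3 := (g (pair z y hz.2)).ne_zero
        simp only [Units.val_inv_eq_inv_val]
        change _ * ((mu.1 (triple (σ x) (σ z) (σ y) _ _) : K) *
          (f.val (σ x) (σ z) * f'.val (σ z) (σ y))) = _
        field_simp
        linear_combination (-(f.val (σ x) (σ z) * f'.val (σ z) (σ y))) * key
      · rw [dif_neg hz, dif_neg fun h' => hz ⟨σ.le_iff_le.1 h'.1, σ.le_iff_le.1 h'.2⟩, mul_zero])

/-! ### Diagonal idempotents and characters -/

/-- The idempotent `lam(x, x, x)⁻¹ f_{xx}`. -/
noncomputable def idem (lam : AssocParam P K) (x : P) : Deformation lam :=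
  (((lam.1 (triple x x x le_rfl le_rfl))⁻¹ : Kˣ) : K) • basisElt lam.1 x x le_rfl

-- Associativity makes `lam(x, x, b)` independent of `b`, so the one factor `lam(x, x, x)⁻¹`
-- normalizes the whole row.
open Classical in
theorem val_idem_mul (lam : AssocParam P K) (x : P) (f : Deformation lam) (a b : P) :
    (idem lam x * f).val a b = if a = x then f.val a b else 0 := by
  by_cases hab : a ≤ b
  · rw [val_mul, Finset.sum_eq_single a]
    · rw [dif_pos ⟨le_rfl, hab⟩, idem, val_smul, val_basisElt]
      by_cases h : a = x
      · subst h
        rw [if_pos ⟨rfl, rfl⟩, if_pos rfl, lam.2.left_eq a b hab, mul_one, ← mul_assoc,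
          Units.mul_inv, one_mul]
      · rw [if_neg fun h' => h h'.1, if_neg h]
        ring
    · intro z _ hz
      have : ¬ (a = x ∧ z = x) := fun h => hz (h.2.trans h.1.symm)
      simp [idem, val_smul, val_basisElt, this]
    · simp
  · rw [val_eq_zero _ hab, val_eq_zero _ hab, ite_self]

open Classical in
theorem val_mul_idem (lam : AssocParam P K) (x : P) (f : Deformation lam) (a b : P) :
    (f * idem lam x).val a b = if b = x then f.val a b else 0 := by
  by_cases hab : a ≤ b
  · rw [val_mul, Finset.sum_eq_single b]
    · rw [dif_pos ⟨hab, le_rfl⟩, idem, val_smul, val_basisElt]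
      by_cases h : b = x
      · subst h
        rw [if_pos ⟨rfl, rfl⟩, if_pos rfl, lam.2.right_eq a b hab, mul_one, mul_comm (f.val a b),
          ← mul_assoc, Units.mul_inv, one_mul]
      · rw [if_neg fun h' => h h'.1, if_neg h]
        ring
    · intro z _ hz
      have : ¬ (z = x ∧ b = x) := fun h => hz (h.1.trans h.2.symm)
      simp [idem, val_smul, val_basisElt, this]
    · simp
  · rw [val_eq_zero _ hab, val_eq_zero _ hab, ite_self]

/-- The Peirce corners are at most one-dimensional: they recover the order of `P` and each `f_{xy}`
up to a scalar. -/
theorem idem_mul_mul_idem (lam : AssocParam P K) (x y : P) (h : x ≤ y) (f : Deformation lam) :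
    idem lam x * f * idem lam y = f.val x y • basisElt lam.1 x y h := by
  classical
  refine val_ext fun a b _ => ?_
  rw [val_mul_idem, val_idem_mul, val_smul, val_basisElt]
  by_cases ha : a = x <;> by_cases hb : b = y <;> simp [ha, hb]

theorem idem_mul_mul_idem_of_not_le (lam : AssocParam P K) (x y : P) (h : ¬ x ≤ y)
    (f : Deformation lam) : idem lam x * f * idem lam y = 0 := by
  classical
  refine val_ext fun a b hab => ?_
  rw [val_mul_idem, val_idem_mul, val_zero]
  split_ifs with hb ha
  · exact absurd (ha ▸ hb ▸ hab) h
  · rfl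
  · rfl

theorem idem_mul_basisElt_mul_idem (lam : AssocParam P K) (x y : P) (h : x ≤ y) :
    idem lam x * basisElt lam.1 x y h * idem lam y = basisElt lam.1 x y h := by
  rw [idem_mul_mul_idem lam x y h, val_basisElt, if_pos ⟨rfl, rfl⟩, one_smul]

open Classical in
theorem idem_mul_idem (lam : AssocParam P K) (x y : P) :
    idem lam x * idem lam y = if x = y then idem lam x else 0 := by
  refine val_ext fun a b _ => ?_
  rw [val_idem_mul]
  split_ifs with ha h h
  · rw [h]
  · have : ¬ (a = y ∧ b = y) := fun h' => h (ha.symm.trans h'.1)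
    simp [idem, val_smul, val_basisElt, this, val_zero]
  · have : ¬ (a = x ∧ b = x) := fun h' => ha h'.1
    simp [idem, val_smul, val_basisElt, this]
  · rfl

theorem sum_idem (lam : AssocParam P K) : ∑ x, idem lam x = 1 := by
  classical
  refine val_ext fun a b hab => ?_
  rw [val_sum]
  conv_lhs => enter [2, x]; rw [← mul_one (idem lam x), val_idem_mul]
  simp

/-- The value `lam(x, x, x) f(x, x)` as an algebra homomorphism. -/
noncomputable def character (lam : AssocParam P K) (x : P) : Deformation lam →ₐ[K] K :=
  AlgHom.ofLinearMap
    { toFun := fun f => (lam.1 (triple x x x le_rfl le_rfl) : K) * f.val x x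
      map_add' := fun f g => by rw [val_add, mul_add]
      map_smul' := fun c f => by
        rw [val_smul, RingHom.id_apply, smul_eq_mul]
        ring }
    (by simp [val_one])
    (fun f g => by
      classical
      change _ * (f * g).val x x = _ * f.val x x * (_ * g.val x x)
      -- The interval from `x` to `x` is a single point, so diagonal entries multiply separately.
      rw [val_mul, Finset.sum_eq_single x]
      · rw [dif_pos ⟨le_rfl, le_rfl⟩]
        ring
      · intro z _ hz
        exact dif_neg fun h => hz (le_antisymm h.2 h.1)
      · simp)

theorem character_apply (lam : AssocParam P K) (x : P) (f : Deformation lam) :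
    character lam x f = (lam.1 (triple x x x le_rfl le_rfl) : K) * f.val x x := rfl

open Classical in
theorem character_idem (lam : AssocParam P K) (x y : P) :
    character lam x (idem lam y) = if x = y then 1 else 0 := by
  rw [character_apply, ← mul_one (idem lam y), val_idem_mul, val_one, if_pos rfl]
  split_ifs
  · exact Units.mul_inv _
  · exact mul_zero _

/-- The `ψ (idem lam x)` are idempotents of a field with sum 1, so one of them is 1. For that `x`,
`ψ f` equals `ψ` of the compression of `f` by `idem lam x`, which is a multiple of `idem lam x`. -/
theorem exists_eq_character (lam : AssocParam P K) (ψ : Deformation lam →ₐ[K] K) :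
    ∃ x, ψ = character lam x := by
  have h1 : ∑ x, ψ (idem lam x) = 1 := by rw [← map_sum, sum_idem, map_one]
  obtain ⟨x, -, hx⟩ := Finset.exists_ne_zero_of_sum_ne_zero (h1.trans_ne one_ne_zero)
  have h2 : ψ (idem lam x) = 1 := by
    have := congrArg ψ (idem_mul_idem lam x x)
    rw [if_pos rfl, map_mul] at this
    exact mul_right_cancel₀ hx (this.trans (one_mul _).symm)
  refine ⟨x, AlgHom.ext fun f => ?_⟩
  have h3 : basisElt lam.1 x x le_rfl =
      (lam.1 (triple x x x le_rfl le_rfl) : K) • idem lam x := by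
    rw [idem, smul_smul, Units.mul_inv, one_smul]
  have h4 := congrArg ψ (idem_mul_mul_idem lam x x le_rfl f)
  rw [h3, map_mul, map_mul, map_smul, map_smul, h2] at h4
  rw [character_apply]
  simpa [mul_comm] using h4

theorem character_injective (lam : AssocParam P K) : Function.Injective (character lam) := by
  classical
  intro x y h
  have := congrArg (fun ψ => ψ (idem lam y)) h
  simpa [character_idem] using this

/-- An isomorphism of deformations permutes the characters. -/
theorem exists_equiv_character {lam mu : AssocParam P K} (φ : Deformation lam ≃ₐ[K] Deformation mu) :
    ∃ σ : P ≃ P, ∀ x a, character mu (σ x) (φ a) = character lam x a := by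
  choose τ hτ using fun x => exists_eq_character mu ((character lam x).comp φ.symm.toAlgHom)
  choose ρ hρ using fun y => exists_eq_character lam ((character mu y).comp φ.toAlgHom)
  have hτ' (x a) : character mu (τ x) (φ a) = character lam x a := by
    rw [← hτ]
    simp
  have hρ' (y b) : character lam (ρ y) (φ.symm b) = character mu y b := by
    rw [← hρ]
    simp
  -- `τ` and `ρ` are mutually inverse because distinct points have distinct characters.
  refine ⟨⟨τ, ρ, fun x => ?_, fun y => ?_⟩, hτ'⟩
  · refine character_injective lam (AlgHom.ext fun a => ?_)
    rw [← hτ' x a, ← hρ' (τ x) (φ a), φ.symm_apply_apply]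
  · refine character_injective mu (AlgHom.ext fun b => ?_)
    rw [← hρ' y b, ← hτ' (ρ y) (φ.symm b), φ.apply_symm_apply]

/-! ### Units and conjugation -/

instance (lam : AssocParam P K) : Module.Finite K (Deformation lam) :=
  Module.Finite.of_injective
    ({ toFun := fun f => f.val
       map_add' := fun _ _ => rfl
       map_smul' := fun _ _ => rfl } : Deformation lam →ₗ[K] P → P → K)
    fun _ _ h => val_ext fun x y _ => congrFun (congrFun h x) y

/-- Back substitution in a triangular system: by induction from the top of `P`, the terms with `z >
x` vanish and only `lam(x,x,y) w(x,x) b(x,y) = 0` is left. -/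
theorem eq_zero_of_mul_eq_zero_of_diagonal {lam : AssocParam P K} {w b : Deformation lam}
    (hw : ∀ x, w.val x x ≠ 0) (h : w * b = 0) : b = 0 := by
  classical
  refine val_ext fun x y hxy => ?_
  rw [val_zero]
  induction x using WellFoundedGT.induction with
  | ind x ih =>
  have h1 := congrArg (fun f => f.val x y) h
  simp only [val_zero] at h1
  rw [val_mul, Finset.sum_eq_single x] at h1
  · rw [dif_pos ⟨le_rfl, hxy⟩] at h1
    simpa [hw x] using h1
  · intro z _ hz
    split_ifs with hz'
    · rw [ih z (lt_of_le_of_ne hz'.1 hz.symm) hz'.2, mul_zero, mul_zero]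
    · rfl
  · simp

/-- Left multiplication by `w` is injective, hence surjective in finite dimension. This gives `w * v
= 1`, and cancelling `w` in `w * (v * w) = w` gives `v * w = 1`. -/
theorem isUnit_of_diagonal {lam : AssocParam P K} {w : Deformation lam}
    (hw : ∀ x, w.val x x ≠ 0) : IsUnit w := by
  have hinj : Function.Injective (LinearMap.mulLeft K w) := by
    rw [← LinearMap.ker_eq_bot, LinearMap.ker_eq_bot']
    exact fun b hb => eq_zero_of_mul_eq_zero_of_diagonal hw hb
  obtain ⟨v, hv⟩ := LinearMap.injective_iff_surjective.1 hinj 1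
  rw [LinearMap.mulLeft_apply] at hv
  refine ⟨⟨w, v, hv, hinj ?_⟩, rfl⟩
  simp only [LinearMap.mulLeft_apply]
  rw [← mul_assoc, hv, one_mul, mul_one]

/-- Conjugation `a ↦ w⁻¹ a w` by a unit. -/
def conjEquiv {R A : Type*} [CommSemiring R] [Semiring A] [Algebra R A] (w : Aˣ) : A ≃ₐ[R] A where
  toFun a := ↑w⁻¹ * a * w
  invFun a := w * a * ↑w⁻¹
  left_inv a := by simp [mul_assoc]
  right_inv a := by simp [mul_assoc]
  map_mul' a b := by simp [mul_assoc]
  map_add' a b := by rw [mul_add, add_mul]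
  commutes' r := by
    rw [← Algebra.commutes, mul_assoc, Units.inv_mul, mul_one]

theorem exists_algEquiv_map_idem {lam mu : AssocParam P K}
    (φ : Deformation lam ≃ₐ[K] Deformation mu) :
    ∃ (φ' : Deformation lam ≃ₐ[K] Deformation mu) (σ : P ≃ P),
      ∀ x, φ' (idem lam x) = idem mu (σ x) := by
  classical
  obtain ⟨σ, hσ⟩ := exists_equiv_character φ
  -- The standard intertwiner of two complete families of orthogonal idempotents. Matching the
  -- families by characters makes its diagonal nonzero, hence makes it a unit.
  set w : Deformation mu := ∑ x, φ (idem lam x) * idem mu (σ x) with hw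
  have hdiag (x : P) : character mu (σ x) w = 1 := by
    rw [hw, map_sum, Finset.sum_eq_single x]
    · rw [map_mul, hσ, character_idem, character_idem, if_pos rfl, if_pos rfl, one_mul]
    · intro y _ hy
      rw [map_mul, hσ, character_idem, if_neg hy.symm, zero_mul]
    · simp
  have hunit : IsUnit w := by
    refine isUnit_of_diagonal fun y h => ?_
    have := hdiag (σ.symm y)
    rw [σ.apply_symm_apply, character_apply, h, mul_zero] at this
    exact zero_ne_one this
  -- By orthogonality both sides collapse to `φ (idem lam x) * idem mu (σ x)`.
  have hcomm (x : P) : φ (idem lam x) * w = w * idem mu (σ x) := by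
    rw [hw, Finset.mul_sum, Finset.sum_mul, Finset.sum_eq_single x, Finset.sum_eq_single x]
    · rw [← mul_assoc, ← map_mul, idem_mul_idem, if_pos rfl, mul_assoc, idem_mul_idem, if_pos rfl]
    · intro y _ hy
      rw [mul_assoc, idem_mul_idem, if_neg (fun h => hy (σ.injective h)), mul_zero]
    · simp
    · intro y _ hy
      rw [← mul_assoc, ← map_mul, idem_mul_idem, if_neg hy.symm, map_zero, zero_mul]
    · simp
  obtain ⟨u, hu⟩ := hunit
  refine ⟨φ.trans (conjEquiv u), σ, fun x => ?_⟩
  change ↑u⁻¹ * φ (idem lam x) * u = _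
  rw [mul_assoc, hu, hcomm, ← hu, Units.inv_mul_cancel_left]

/-- Otherwise the nonzero element `φ f_{xy}` would lie in a zero corner. -/
theorem le_of_map_idem {lam mu : AssocParam P K} (φ : Deformation lam ≃ₐ[K] Deformation mu)
    (σ : P ≃ P) (hφ : ∀ x, φ (idem lam x) = idem mu (σ x)) {x y : P} (h : x ≤ y) : σ x ≤ σ y := by
  by_contra hn
  have h1 := congrArg φ (idem_mul_basisElt_mul_idem lam x y h)
  rw [map_mul, map_mul, hφ, hφ, idem_mul_mul_idem_of_not_le mu _ _ hn] at h1
  exact basisElt_ne_zero lam.1 x y h ((map_eq_zero_iff φ φ.injective).1 h1.symm)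

/-- Isomorphic deformations have parameters that agree up to an automorphism of the poset and a
coboundary. -/
theorem exists_pullback_mul_coboundary {lam mu : AssocParam P K}
    (φ : Deformation lam ≃ₐ[K] Deformation mu) :
    ∃ (σ : P ≃o P) (g : Cochain P K 1),
      lam.1 = pullback P K 2 σ mu.1 * coboundary P K 1 g := by
  classical
  obtain ⟨φ, σ, hφ⟩ := exists_algEquiv_map_idem φ
  have hφ' (y : P) : φ.symm (idem mu y) = idem lam (σ.symm y) := by
    rw [AlgEquiv.symm_apply_eq, hφ, σ.apply_symm_apply]
  let τ : P ≃o P :=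
    { σ with
      map_rel_iff' := fun {x y} => ⟨fun h => by
        simpa using le_of_map_idem φ.symm σ.symm hφ' h, le_of_map_idem φ σ hφ⟩ }
  -- `φ` maps the corner at `(x, y)` into the corner at `(τ x, τ y)`, which is a line.
  have hbasis (x y : P) (h : x ≤ y) : φ (basisElt lam.1 x y h) =
      (φ (basisElt lam.1 x y h)).val (τ x) (τ y) •
        basisElt mu.1 (τ x) (τ y) (τ.monotone h) := by
    have h1 := congrArg φ (idem_mul_basisElt_mul_idem lam x y h)
    rw [map_mul, map_mul, hφ, hφ] at h1
    exact h1.symm.trans (idem_mul_mul_idem mu (τ x) (τ y) (τ.monotone h) _)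
  have hne (x y : P) (h : x ≤ y) : (φ (basisElt lam.1 x y h)).val (τ x) (τ y) ≠ 0 := by
    intro h0
    have h1 := hbasis x y h
    rw [h0, zero_smul] at h1
    exact basisElt_ne_zero lam.1 x y h ((map_eq_zero_iff φ φ.injective).1 h1)
  let g : Cochain P K 1 := fun s => Units.mk0 _ (hne (s 0) (s 1) (s.monotone (by decide)))
  have hg (x y : P) (h : x ≤ y) : φ (basisElt lam.1 x y h) =
      (g (pair x y h) : K) • basisElt mu.1 (τ x) (τ y) (τ.monotone h) := hbasis x y h
  suffices h : ∀ (x y z : P) (hxy : x ≤ y) (hyz : y ≤ z), lam.1 (triple x y z hxy hyz) =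
      (pullback P K 2 τ mu.1 * coboundary P K 1 g) (triple x y z hxy hyz) by
    refine ⟨τ, g, funext fun s => ?_⟩
    rw [chain_two_eq_triple s]
    exact h _ _ _ _ _
  intro x y z hxy hyz
  rw [Pi.mul_apply, coboundary_one_triple]
  have hp : pullback P K 2 τ mu.1 (triple x y z hxy hyz) =
      mu.1 (triple (τ x) (τ y) (τ z) (τ.monotone hxy) (τ.monotone hyz)) := by
    refine congrArg mu.1 ?_
    ext i; fin_cases i <;> rfl
  -- Applying `φ` to `f_{xy} f_{yz} = lam(x,y,z) f_{xz}` gives `g(x,y) g(y,z) mu(τx,τy,τz) =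
  -- lam(x,y,z) g(x,z)`.
  have h1 := congrArg φ (basisElt_mul_basisElt (lam := lam.1) x y z hxy hyz)
  have h2 : φ (basisElt lam.1 x y hxy) * φ (basisElt lam.1 y z hyz) =
      (lam.1 (triple x y z hxy hyz) : K) • φ (basisElt lam.1 x z (hxy.trans hyz)) := by
    rw [← map_smul, ← map_mul]
    exact h1
  rw [hg, hg, hg, smul_mul_eq, mul_smul_eq, basisElt_mul_basisElt] at h2
  have h3 := congrArg (fun f => f.val (τ x) (τ z)) h2
  simp only [val_smul, val_basisElt, and_self, if_true, mul_one, ← Units.val_mul] at h3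
  have h4 := Units.ext h3
  rw [hp, ← mul_left_inj (g (pair x z (hxy.trans hyz))), ← h4, mul_mul_inv_mul_mul_eq,
    mul_assoc]

theorem nonempty_algEquiv_of_pullback_mul_coboundary {lam mu : AssocParam P K} (σ : P ≃o P)
    (g : Cochain P K 1) (h : lam.1 = pullback P K 2 σ mu.1 * coboundary P K 1 g) :
    Nonempty (Deformation mu ≃ₐ[K] Deformation lam) := by
  refine ⟨deformationEquiv lam mu σ g fun x y z hxy hyz => ?_⟩
  have hp : pullback P K 2 σ mu.1 (triple x y z hxy hyz) =
      mu.1 (triple (σ x) (σ y) (σ z) (σ.monotone hxy) (σ.monotone hyz)) := by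
    refine congrArg mu.1 ?_
    ext i; fin_cases i <;> rfl
  rw [h, Pi.mul_apply, coboundary_one_triple, hp, mul_mul_inv_mul_mul_eq]

/-! ### The classification -/

variable (P K) in
/-- The orbit of the cohomology class of a parameter. -/
def paramOrbit (lam : AssocParam P K) : CohomologyOrbits P K 2 :=
  cohomologyOrbit P K (cohomologyClass P K ⟨lam.1, lam.2.mem_cocycles⟩)

theorem paramOrbit_eq_iff (lam mu : AssocParam P K) :
    paramOrbit P K lam = paramOrbit P K mu ↔
      ∃ (σ : P ≃o P) (g : Cochain P K 1),
        lam.1 = pullback P K 2 σ mu.1 * coboundary P K 1 g := by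
  have key (σ : P ≃o P) :
      MulOpposite.op σ • cohomologyClass P K ⟨mu.1, mu.2.mem_cocycles⟩ =
        cohomologyClass P K ⟨lam.1, lam.2.mem_cocycles⟩ ↔
      ∃ g : Cochain P K 1, lam.1 = pullback P K 2 σ mu.1 * coboundary P K 1 g := by
    -- The action pulls back representatives, so equality of classes says that `lam` divided by the
    -- pullback of `mu` is a coboundary.
    change (QuotientGroup.mk (pullbackCocycles P K 2 σ ⟨mu.1, mu.2.mem_cocycles⟩) :
      Cohomology P K 2) = QuotientGroup.mk _ ↔ _
    rw [QuotientGroup.eq]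
    change (∃ g, coboundary P K 1 g = (pullback P K 2 σ mu.1)⁻¹ * lam.1) ↔ _
    simp only [eq_inv_mul_iff_mul_eq, eq_comm]
  change Quotient.mk (MulAction.orbitRel _ _) _ = Quotient.mk (MulAction.orbitRel _ _) _ ↔ _
  rw [Quotient.eq, MulAction.orbitRel_apply, MulAction.mem_orbit_iff, MulOpposite.exists]
  exact exists_congr key

theorem paramOrbit_eq_iff_nonempty_algEquiv (lam mu : AssocParam P K) :
    paramOrbit P K lam = paramOrbit P K mu ↔
      Nonempty (Deformation lam ≃ₐ[K] Deformation mu) := by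
  rw [paramOrbit_eq_iff]
  constructor
  · rintro ⟨σ, g, h⟩
    obtain ⟨e⟩ := nonempty_algEquiv_of_pullback_mul_coboundary σ g h
    exact ⟨e.symm⟩
  · rintro ⟨φ⟩
    exact exists_pullback_mul_coboundary φ

theorem paramOrbit_surjective : Function.Surjective (paramOrbit P K) := by
  intro o
  induction o using Quotient.inductionOn with
  | h c =>
  induction c using QuotientGroup.induction_on with
  | H f => exact ⟨⟨f.1, isAssoc_of_mem_cocycles f.2⟩, rfl⟩

variable (P K) in
/-- The bijection from isomorphism classes of deformations to orbits of cohomology classes. -/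
noncomputable def deformationClassesEquiv : DeformationClasses P K ≃ CohomologyOrbits P K 2 :=
  Equiv.ofBijective
    (Quotient.lift (paramOrbit P K) fun lam mu h =>
      (paramOrbit_eq_iff_nonempty_algEquiv lam mu).2 h)
    ⟨by
      intro a b
      induction a, b using Quotient.inductionOn₂ with
      | h lam mu =>
      exact fun h => Quotient.sound ((paramOrbit_eq_iff_nonempty_algEquiv lam mu).1 h),
    fun o => (paramOrbit_surjective o).imp' (Quotient.mk _) fun _ h => h⟩

end Algebra

end PosetDeformation

theorem theorem4p5 (P : Type*) [PartialOrder P] [Fintype P] (K : Type*) [Field K] :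
    ∃ e : PosetDeformation.DeformationClasses P K ≃ PosetDeformation.CohomologyOrbits P K 2,
      ∀ lam : PosetDeformation.AssocParam P K,
        ∃ hlam : lam.1 ∈ PosetDeformation.cocycles P K 2,
          e (PosetDeformation.deformationClass lam) =
            PosetDeformation.cohomologyOrbit P K
              (PosetDeformation.cohomologyClass P K ⟨lam.1, hlam⟩) :=
  -- The bijection is a quotient lift of `paramOrbit`, so its value on a class holds by `rfl`.
  ⟨PosetDeformation.deformationClassesEquiv P K, fun lam => ⟨lam.2.mem_cocycles, rfl⟩⟩
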